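/- Let $\mathbb{O}_c$ be the real (compact, 8-dimensional division) algebra of octonions and let $\mathbb{O}=\mathbb{C}\otimes_{\mathbb{R}}\mathbb{O}_c$ be the complex Cayley algebra, with the product, the Cayley conjugation $a\mapsto\tilde a$ and the norm $n(a)=a\tilde a$ extended $\mathbb{C}$-linearly (respectively as a complex quadratic form) from $\mathbb{O}_c$, with the $\mathbb C$-bilinear form $(a:b)=n(a+b)-n(a)-n(b)$, and with the complex conjugation $a\mapsto\bar a$ relative to the real form $\mathbb{O}_c$. Let $H_3(\mathbb{O})$ be the complex vector space of $3\times3$ matrices over $\mathbb{O}$ that are Hermitian with respect to the Cayley conjugation, written $$a=\begin{pmatrix}\alpha_1&a_3&\tilde a_2\\ \tilde a_3&\alpha_2&a_1\\ a_2&\tilde a_1&\alpha_3\end{pmatrix}=\sum_i\alpha_ie_i+\sum_iF_i(a_i)\qquad(\alpha_i\in\mathbb{C},\ a_i\in\mathbb{O}).$$ Put $(a:b)=\sum_i\alpha_i\beta_i+\sum_i(a_i:b_i)$, $\ \bar a=\sum_i\bar\alpha_ie_i+\sum_iF_i(\bar a_i)$, $\ (a\mid b)=(a:\bar b)$, $$a^{\#}=\sum_i(\alpha_j\alpha_k-n(a_i))\,e_i+\sum_iF_i\bigl((a_ja_k-\alpha_i\tilde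 a_i)^{\sim}\bigr),$$ where $(i,j,k)$ denotes the even permutation of $(1,2,3)$ starting with $i$, and $$a\times b=(a+b)^{\#}-a^{\#}-b^{\#},\qquad \det a=\tfrac13(a^{\#}:a).$$ Define the operators $$D(x,y)z=(x\mid y)z+(z\mid y)x-(x\times z)\times\bar y,\qquad Q(x)y=(x\mid y)x-x^{\#}\times\bar y,$$ and the Bergman operator $B(x,y)=\mathrm{id}-D(x,y)+Q(x)Q(y)$. The operators $D(x,y)$ and $B(x,y)$ are $\mathbb{C}$-linear. Then for all $x,y\in H_3(\mathbb{O})$, $$\operatorname{Tr}D(x,y)=18\,(x\mid y),$$ $$\operatorname{Det}B(x,y)=\bigl(1-(x\mid y)+(x^{\#}\mid y^{\#})-\det x\,\det\bar y\bigr)^{18},$$ where $\operatorname{Tr}$ and $\operatorname{Det}$ are the trace and the determinant of $\mathbb{C}$-linear operators on $H_3(\mathbb{O})$. -/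

import Mathlib

namespace ExceptionalJordan

/-- The Cayley algebra over `R`, as the Cayley--Dickson double `A ⊕ vA`, `v ^ 2 = -1`, of the
quaternion algebra `A` over `R` (basis `1, i, j, k` with `i ^ 2 = j ^ 2 = -1`).
The element `⟨a, b⟩` stands for `a + v b`. For `R = ℝ` this is the compact
Cayley algebra of octonions; for `R = ℂ` it is its complexification. -/
@[ext]
structure Octonion (R : Type) [CommRing R] where
  /-- the component `a` of `a + v b` -/
  fst : Quaternion R
  /-- the component `b` of `a + v b` -/
  snd : Quaternion R

namespace Octonion

variable {R : Type} [CommRing R]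

instance : Zero (Octonion R) := ⟨⟨0, 0⟩⟩
instance : One (Octonion R) := ⟨⟨1, 0⟩⟩
instance : Add (Octonion R) := ⟨fun a b => ⟨a.fst + b.fst, a.snd + b.snd⟩⟩
instance : Neg (Octonion R) := ⟨fun a => ⟨-a.fst, -a.snd⟩⟩
instance : Sub (Octonion R) := ⟨fun a b => ⟨a.fst - b.fst, a.snd - b.snd⟩⟩
instance : SMul R (Octonion R) := ⟨fun c a => ⟨c • a.fst, c • a.snd⟩⟩

/-- The product
`(a₁ + v b₁) (a₂ + v b₂) = a₁ a₂ + μ b₂ b₁~ + v (a₁~ b₂ + a₂ b₁)` with `μ = -1`, where `~` is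
the `R`-linear conjugation of the quaternion algebra. -/
instance : Mul (Octonion R) :=
  ⟨fun a b => ⟨a.fst * b.fst - b.snd * star a.snd, star a.fst * b.snd + b.fst * a.snd⟩⟩

/-- The Cayley conjugation `(a + v b)~ = a~ - v b`; it is `R`-linear, also for `R = ℂ`. -/
instance : Star (Octonion R) := ⟨fun a => ⟨star a.fst, -a.snd⟩⟩

@[simp] theorem zero_fst : (0 : Octonion R).fst = 0 := rfl
@[simp] theorem zero_snd : (0 : Octonion R).snd = 0 := rfl
@[simp] theorem one_fst : (1 : Octonion R).fst = 1 := rfl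
@[simp] theorem one_snd : (1 : Octonion R).snd = 0 := rfl
@[simp] theorem add_fst (a b : Octonion R) : (a + b).fst = a.fst + b.fst := rfl
@[simp] theorem add_snd (a b : Octonion R) : (a + b).snd = a.snd + b.snd := rfl
@[simp] theorem neg_fst (a : Octonion R) : (-a).fst = -a.fst := rfl
@[simp] theorem neg_snd (a : Octonion R) : (-a).snd = -a.snd := rfl
@[simp] theorem sub_fst (a b : Octonion R) : (a - b).fst = a.fst - b.fst := rfl
@[simp] theorem sub_snd (a b : Octonion R) : (a - b).snd = a.snd - b.snd := rfl
@[simp] theorem smul_fst (c : R) (a : Octonion R) : (c • a).fst = c • a.fst := rfl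
@[simp] theorem smul_snd (c : R) (a : Octonion R) : (c • a).snd = c • a.snd := rfl
@[simp] theorem star_fst (a : Octonion R) : (star a).fst = star a.fst := rfl
@[simp] theorem star_snd (a : Octonion R) : (star a).snd = -a.snd := rfl
@[simp] theorem mul_fst (a b : Octonion R) :
    (a * b).fst = a.fst * b.fst - b.snd * star a.snd := rfl
@[simp] theorem mul_snd (a b : Octonion R) :
    (a * b).snd = star a.fst * b.snd + b.fst * a.snd := rfl

instance : AddCommGroup (Octonion R) where
  add_assoc a b c := by ext1 <;> simp [add_assoc]
  zero_add a := by ext1 <;> simp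
  add_zero a := by ext1 <;> simp
  add_comm a b := by ext1 <;> simp [add_comm]
  neg_add_cancel a := by ext1 <;> simp
  sub_eq_add_neg a b := by ext1 <;> simp [sub_eq_add_neg]
  nsmul := nsmulRec
  zsmul := zsmulRec

instance : Module R (Octonion R) where
  one_smul a := by ext1 <;> simp
  mul_smul c d a := by ext1 <;> simp [mul_smul]
  smul_zero c := by ext1 <;> simp
  smul_add c a b := by ext1 <;> simp
  add_smul c d a := by ext1 <;> simp [add_smul]
  zero_smul a := by ext1 <;> simp

instance : NonAssocRing (Octonion R) where
  left_distrib a b c := by ext1 <;> simp [mul_add, add_mul] <;> abel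
  right_distrib a b c := by ext1 <;> simp [mul_add, add_mul] <;> abel
  zero_mul a := by ext1 <;> simp
  mul_zero a := by ext1 <;> simp
  one_mul a := by ext1 <;> simp
  mul_one a := by ext1 <;> simp

theorem smul_mul (c : R) (a b : Octonion R) : (c • a) * b = c • (a * b) := by
  ext1 <;> simp [smul_sub]

theorem mul_smul' (c : R) (a b : Octonion R) : a * (c • b) = c • (a * b) := by
  ext1 <;> simp [smul_sub]

instance : StarAddMonoid (Octonion R) where
  star_involutive a := by ext1 <;> simp
  star_add a b := by ext1 <;> simp [add_comm]

theorem star_smul' (c : R) (a : Octonion R) : star (c • a) = c • star a := by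
  ext1 <;> simp

/-- The norm `n (a + v b) = n a + n b`, a quadratic form with values in `R`. -/
def norm (a : Octonion R) : R := Quaternion.normSq a.fst + Quaternion.normSq a.snd

/-- The scalar product `(a : b) = n (a + b) - n a - n b`, without a factor `1 / 2`. -/
def bil (a b : Octonion R) : R := norm (a + b) - norm a - norm b

/-- `a a~ = a~ a = n a`. -/
theorem mul_star_self (a : Octonion R) : a * star a = norm a • 1 ∧ star a * a = norm a • 1 := by
  constructor <;> ext <;>
    simp [norm, Quaternion.normSq_def', Quaternion.re_one, Quaternion.imI_one,
      Quaternion.imJ_one, Quaternion.imK_one] <;>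
    ring

/-- The norm is multiplicative: the Cayley algebra is a composition algebra. -/
theorem norm_mul (a b : Octonion R) : norm (a * b) = norm a * norm b := by
  simp [norm, Quaternion.normSq_def']
  ring

theorem bil_eq (a b : Octonion R) : bil a b =
    2 * (a.fst.re * b.fst.re + a.fst.imI * b.fst.imI + a.fst.imJ * b.fst.imJ
      + a.fst.imK * b.fst.imK + a.snd.re * b.snd.re + a.snd.imI * b.snd.imI
      + a.snd.imJ * b.snd.imJ + a.snd.imK * b.snd.imK) := by
  simp [bil, norm, Quaternion.normSq_def']
  ring

theorem bil_add_left (a b c : Octonion R) : bil (a + b) c = bil a c + bil b c := by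
  simp [bil_eq]; ring

theorem bil_smul_left (r : R) (a b : Octonion R) : bil (r • a) b = r * bil a b := by
  simp [bil_eq]; ring

theorem bil_comm (a b : Octonion R) : bil a b = bil b a := by
  simp [bil_eq]; ring

/-- Application of a map to the eight coordinates of an element of a Cayley algebra. -/
def mapCoord {S : Type} [CommRing S] (f : R → S) (a : Octonion R) : Octonion S :=
  ⟨⟨f a.fst.re, f a.fst.imI, f a.fst.imJ, f a.fst.imK⟩,
    ⟨f a.snd.re, f a.snd.imI, f a.snd.imJ, f a.snd.imK⟩⟩

section mapCoord

variable {S : Type} [CommRing S] (f : R → S) (a : Octonion R)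

@[simp] theorem mapCoord_fst_re : (mapCoord f a).fst.re = f a.fst.re := rfl
@[simp] theorem mapCoord_fst_imI : (mapCoord f a).fst.imI = f a.fst.imI := rfl
@[simp] theorem mapCoord_fst_imJ : (mapCoord f a).fst.imJ = f a.fst.imJ := rfl
@[simp] theorem mapCoord_fst_imK : (mapCoord f a).fst.imK = f a.fst.imK := rfl
@[simp] theorem mapCoord_snd_re : (mapCoord f a).snd.re = f a.snd.re := rfl
@[simp] theorem mapCoord_snd_imI : (mapCoord f a).snd.imI = f a.snd.imI := rfl
@[simp] theorem mapCoord_snd_imJ : (mapCoord f a).snd.imJ = f a.snd.imJ := rfl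
@[simp] theorem mapCoord_snd_imK : (mapCoord f a).snd.imK = f a.snd.imK := rfl

end mapCoord

/-- The complex conjugation of the complex Cayley algebra with respect to its real form, the
compact Cayley algebra: complex conjugation of the eight coordinates. -/
noncomputable def conj (a : Octonion ℂ) : Octonion ℂ := mapCoord (starRingEnd ℂ) a

theorem conj_add (a b : Octonion ℂ) : conj (a + b) = conj a + conj b := by
  ext <;> simp [conj]

theorem conj_smul (c : ℂ) (a : Octonion ℂ) :
    conj (c • a) = (starRingEnd ℂ) c • conj a := by
  ext <;> simp [conj]

/-- The inclusion of the compact Cayley algebra in the complex Cayley algebra. -/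
noncomputable def ofReal (a : Octonion ℝ) : Octonion ℂ := mapCoord Complex.ofReal a

theorem ofReal_mul (a b : Octonion ℝ) : ofReal (a * b) = ofReal a * ofReal b := by
  ext <;> simp [ofReal]

/-- The complex Cayley algebra is the complexification of the compact one, and `conj` is the
complex conjugation attached to this real form. -/
theorem existsUnique_ofReal (a : Octonion ℂ) :
    ∃! p : Octonion ℝ × Octonion ℝ, a = ofReal p.1 + Complex.I • ofReal p.2 ∧
      conj a = ofReal p.1 - Complex.I • ofReal p.2 := by
  refine ⟨⟨mapCoord Complex.re a, mapCoord Complex.im a⟩, ⟨?_, ?_⟩, ?_⟩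
  · ext <;> apply Complex.ext <;> simp [ofReal]
  · ext <;> apply Complex.ext <;> simp [ofReal, conj]
  · rintro ⟨p, q⟩ ⟨rfl, -⟩
    ext <;> simp [ofReal]

end Octonion

/-- The `ℂ`-vector space of `3 × 3` matrices over the complex Cayley algebra that are Hermitian
with respect to the Cayley conjugation. -/
def H3 : Submodule ℂ (Matrix (Fin 3) (Fin 3) (Octonion ℂ)) where
  carrier := {A | A.IsHermitian}
  add_mem' hA hB := Matrix.IsHermitian.add hA hB
  zero_mem' := Matrix.isHermitian_zero
  smul_mem' c A hA := Matrix.IsHermitian.ext fun i j => by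
    rw [Matrix.smul_apply, Matrix.smul_apply, Octonion.star_smul', Matrix.IsHermitian.apply hA]

/-- The diagonal coordinates `αᵢ` of a Hermitian matrix (its diagonal entries are the scalars
`αᵢ • 1`). -/
def diag (a : H3) (i : Fin 3) : ℂ := (a.1 i i).fst.re

/-- The off-diagonal coordinates: `a₁`, `a₂`, `a₃` are the entries in the places
`(2, 3)`, `(3, 1)`, `(1, 2)`. -/
def off (a : H3) (i : Fin 3) : Octonion ℂ := a.1 (i + 1) (i + 2)

/-- The Hermitian matrix `∑ αᵢ eᵢ + ∑ Fᵢ(aᵢ)`. -/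
def of (α : Fin 3 → ℂ) (a : Fin 3 → Octonion ℂ) : H3 :=
  ⟨!![α 0 • 1, a 2, star (a 1);
      star (a 2), α 1 • 1, a 0;
      a 1, star (a 0), α 2 • 1], Matrix.IsHermitian.ext fun i j => by
    fin_cases i <;> fin_cases j <;> simp <;> ext <;> simp⟩

@[simp] theorem diag_of (α : Fin 3 → ℂ) (a : Fin 3 → Octonion ℂ) (i : Fin 3) :
    diag (of α a) i = α i := by
  fin_cases i <;> simp [diag, of, Quaternion.re_one]

@[simp] theorem off_of (α : Fin 3 → ℂ) (a : Fin 3 → Octonion ℂ) (i : Fin 3) :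
    off (of α a) i = a i := by
  fin_cases i <;> simp [off, of]

theorem of_diag_off (a : H3) : of (diag a) (off a) = a := by
  obtain ⟨A, hA⟩ := a
  have key : ∀ i, A i i = (A i i).fst.re • (1 : Octonion ℂ) := fun i => by
    have h := Matrix.IsHermitian.apply hA i i
    have hf := Quaternion.ext_iff.mp (congrArg Octonion.fst h)
    have hs := Quaternion.ext_iff.mp (congrArg Octonion.snd h)
    simp only [Octonion.star_fst, Octonion.star_snd, Quaternion.re_star, Quaternion.imI_star,
      Quaternion.imJ_star, Quaternion.imK_star, Quaternion.re_neg, Quaternion.imI_neg,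
      Quaternion.imJ_neg, Quaternion.imK_neg, neg_eq_self] at hf hs
    ext <;> simp [hf, hs, Quaternion.re_one, Quaternion.imI_one, Quaternion.imJ_one,
      Quaternion.imK_one, Quaternion.re_zero, Quaternion.imI_zero, Quaternion.imJ_zero,
      Quaternion.imK_zero]
  apply Subtype.ext
  apply Matrix.ext
  intro i j
  have hs := Matrix.IsHermitian.apply hA
  fin_cases i <;> fin_cases j <;> simp [of, diag, off, ← key, hs]

theorem H3_ext {a b : H3} (h₁ : ∀ i, diag a i = diag b i) (h₂ : ∀ i, off a i = off b i) :
    a = b := by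
  rw [← of_diag_off a, ← of_diag_off b, funext h₁, funext h₂]

@[simp] theorem diag_add (a b : H3) (i : Fin 3) : diag (a + b) i = diag a i + diag b i := rfl
@[simp] theorem diag_sub (a b : H3) (i : Fin 3) : diag (a - b) i = diag a i - diag b i := rfl
@[simp] theorem diag_smul (c : ℂ) (a : H3) (i : Fin 3) : diag (c • a) i = c * diag a i := rfl
@[simp] theorem off_add (a b : H3) (i : Fin 3) : off (a + b) i = off a i + off b i := rfl
@[simp] theorem off_sub (a b : H3) (i : Fin 3) : off (a - b) i = off a i - off b i := rfl
@[simp] theorem off_smul (c : ℂ) (a : H3) (i : Fin 3) : off (c • a) i = c • off a i := rfl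

/-- The scalar product `(a : b) = ∑ αᵢ βᵢ + ∑ (aᵢ : bᵢ)`. -/
def bil (a b : H3) : ℂ := ∑ i, diag a i * diag b i + ∑ i, Octonion.bil (off a i) (off b i)

/-- The adjoint
`a# = ∑ᵢ (αⱼ αₖ - n aᵢ) eᵢ + ∑ᵢ Fᵢ((aⱼ aₖ - αᵢ aᵢ~)~)`, where `(i, j, k)` runs through the
even permutations of the three indices, i.e. `j = i + 1` and `k = i + 2` modulo `3`. -/
def adj (a : H3) : H3 :=
  of (fun i => diag a (i + 1) * diag a (i + 2) - Octonion.norm (off a i))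
    (fun i => star (off a (i + 1) * off a (i + 2) - diag a i • star (off a i)))

/-- The Freudenthal product `a × b = (a + b)# - a# - b#`. -/
def cross (a b : H3) : H3 := adj (a + b) - adj a - adj b

/-- The determinant `det a = (1 / 3!) (a × a : a) = (1 / 3) (a# : a)`. -/
noncomputable def det (a : H3) : ℂ := (1 / 3) * bil (adj a) a

/-- The complex conjugation, applied to all coordinates. -/
noncomputable def conj (a : H3) : H3 :=
  of (fun i => (starRingEnd ℂ) (diag a i)) (fun i => Octonion.conj (off a i))

/-- The Hermitian scalar product `(a | b) = (a : b̄)`, linear in `a`, antilinear in `b`. -/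
noncomputable def herm (a b : H3) : ℂ := bil a (conj b)

theorem bil_add_left (a b c : H3) : bil (a + b) c = bil a c + bil b c := by
  simp only [bil, diag_add, off_add, add_mul, Octonion.bil_add_left, Finset.sum_add_distrib]
  ring

theorem bil_smul_left (r : ℂ) (a b : H3) : bil (r • a) b = r * bil a b := by
  simp only [bil, diag_smul, off_smul, Octonion.bil_smul_left, mul_add, Finset.mul_sum, mul_assoc]

theorem bil_comm (a b : H3) : bil a b = bil b a := by
  simp only [bil, mul_comm, Octonion.bil_comm]

theorem diag_cross (a b : H3) (i : Fin 3) : diag (cross a b) i =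
    diag a (i + 1) * diag b (i + 2) + diag a (i + 2) * diag b (i + 1)
      - Octonion.bil (off a i) (off b i) := by
  simp only [cross, adj, diag_sub, diag_of, diag_add, off_add, Octonion.bil]
  ring

theorem off_cross (a b : H3) (i : Fin 3) : off (cross a b) i =
    star (off a (i + 1) * off b (i + 2) + off b (i + 1) * off a (i + 2)
      - diag a i • star (off b i) - diag b i • star (off a i)) := by
  simp only [cross, adj, off_sub, off_of, diag_add, off_add, mul_add, add_mul, add_smul, smul_add,
    star_add, star_sub]
  abel

theorem cross_comm (a b : H3) : cross a b = cross b a := by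
  simp only [cross, add_comm a b, sub_right_comm]

theorem cross_add_left (a b c : H3) : cross (a + b) c = cross a c + cross b c := by
  refine H3_ext (fun i => ?_) (fun i => ?_)
  · simp only [diag_cross, diag_add, off_add, Octonion.bil_add_left]
    ring
  · simp only [off_cross, diag_add, off_add, mul_add, add_mul, add_smul, smul_add,
      star_add, star_sub]
    abel

theorem cross_smul_left (r : ℂ) (a b : H3) : cross (r • a) b = r • cross a b := by
  refine H3_ext (fun i => ?_) (fun i => ?_)
  · simp only [diag_cross, diag_smul, off_smul, Octonion.bil_smul_left]
    ring
  · simp only [off_cross, diag_smul, off_smul, Octonion.smul_mul, Octonion.mul_smul',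
      Octonion.star_smul', smul_sub, smul_add, star_add, star_sub, mul_smul, smul_comm r]

theorem cross_add_right (a b c : H3) : cross a (b + c) = cross a b + cross a c := by
  rw [cross_comm, cross_add_left, cross_comm b, cross_comm c]

theorem cross_smul_right (r : ℂ) (a b : H3) : cross a (r • b) = r • cross a b := by
  rw [cross_comm, cross_smul_left, cross_comm b]

theorem conj_add (a b : H3) : conj (a + b) = conj a + conj b :=
  H3_ext (fun i => by simp [conj]) (fun i => by simp [conj, Octonion.conj_add])

theorem conj_smul (c : ℂ) (a : H3) : conj (c • a) = (starRingEnd ℂ) c • conj a :=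
  H3_ext (fun i => by simp [conj]) (fun i => by simp [conj, Octonion.conj_smul])

/-- The operator `D(x, y) z = {x y z} = (x | y) z + (z | y) x - (x × z) × ȳ`, which is
`ℂ`-linear in `z`. -/
noncomputable def D (x y : H3) : H3 →ₗ[ℂ] H3 where
  toFun z := herm x y • z + herm z y • x - cross (cross x z) (conj y)
  map_add' z w := by
    simp only [herm, bil_add_left, cross_add_right, cross_add_left, smul_add, add_smul]
    abel
  map_smul' c z := by
    simp only [herm, bil_smul_left, cross_smul_right, cross_smul_left, smul_add, smul_sub,
      mul_smul, smul_comm c, RingHom.id_apply]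

/-- The operator `Q(x) y = (x | y) x - x# × ȳ`, which is `ℂ`-antilinear in `y`. -/
noncomputable def Q (x : H3) : H3 →ₛₗ[starRingEnd ℂ] H3 where
  toFun y := herm x y • x - cross (adj x) (conj y)
  map_add' y z := by
    simp only [herm, conj_add, bil_comm x, bil_add_left, cross_add_right, add_smul]
    abel
  map_smul' c y := by
    simp only [herm, conj_smul, bil_comm x, bil_smul_left, cross_smul_right, smul_sub, mul_smul]

/-- The Bergman operator `B(x, y) = id - D(x, y) + Q(x) Q(y)`, which is `ℂ`-linear. -/
noncomputable def B (x y : H3) : H3 →ₗ[ℂ] H3 := LinearMap.id - D x y + (Q x).comp (Q y)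

end ExceptionalJordan

/-!
Put `w = ȳ`, so that `D(x, y) = V_{x,w}` and `B(x, y) = M(1)` for
`M(t) = 1 - t V_{x,w} + t² U_x U_w`, and let `N(t) = 1 - t (x : w) + t² (x# : w#) - t³ det x det w`.
Three identities between the operators `U` and `V`, valid in any cubic norm structure, amount to
the differential equation `N M' = M L` with `L(t) = t V_{x# × w, w} - V_{x,w} - 2 t² det x det w`.
The trace formula `Tr V_{x,w} = 18 (x : w)` gives `Tr L = 18 N'`, so Jacobi's formula yields
`N (Det M)' = 18 N' Det M`, whence `Det M = N ^ 18`, both sides being `1` at `t = 0`.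
-/

namespace ExceptionalJordan

section PolynomialMatrices

open Polynomial

variable {n R : Type*} [Fintype n] [DecidableEq n] [CommRing R]

theorem adjugate_mul_apply_self (M N : Matrix n n R) (i : n) :
    (M.adjugate * N) i i = (M.updateCol i fun j => N j i).det := by
  rw [← Matrix.cramer_apply, Matrix.cramer_eq_adjugate_mulVec]
  rfl

theorem derivative_det (M : Matrix n n R[X]) :
    derivative M.det = (M.adjugate * M.map derivative).trace := by
  have derivative_term (σ : Equiv.Perm n) :
      derivative (∏ j, M (σ j) j) =
        ∑ i, ∏ j, M.updateCol i (fun l => derivative (M l i)) (σ j) j := by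
    rw [derivative_prod_finset]
    refine Finset.sum_congr rfl fun i _ => ?_
    rw [← Finset.prod_erase_mul _ _ (Finset.mem_univ i), Matrix.updateCol_self]
    congr 1
    refine Finset.prod_congr rfl fun j hj => ?_
    rw [Matrix.updateCol_ne (Finset.ne_of_mem_erase hj)]
  calc derivative M.det
      = ∑ i, (M.updateCol i fun j => derivative (M j i)).det := by
        simp only [Matrix.det_apply, derivative_sum, Units.smul_def, map_zsmul, derivative_term,
          Finset.smul_sum]
        exact Finset.sum_comm
    _ = (M.adjugate * M.map derivative).trace :=
        Finset.sum_congr rfl fun i _ => (adjugate_mul_apply_self M (M.map derivative) i).symm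

theorem mul_derivative_det_eq_trace_mul_det {M N : Matrix n n R[X]} {g : R[X]}
    (h : g • M.map derivative = M * N) : g * derivative M.det = N.trace * M.det := by
  rw [derivative_det, ← smul_eq_mul, ← Matrix.trace_smul, ← Matrix.mul_smul, h,
    ← Matrix.mul_assoc, Matrix.adjugate_mul, Matrix.smul_mul, Matrix.one_mul, Matrix.trace_smul,
    smul_eq_mul, mul_comm]

theorem eq_pow_of_mul_derivative_eq {K : Type*} [Field K] [CharZero K] {f g : K[X]} {k : ℕ}
    (hf : f.coeff 0 = 1) (hg : g.coeff 0 = 1)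
    (h : g * derivative f = k * derivative g * f) : f = g ^ k := by
  let F : PowerSeries K := f
  let G : PowerSeries K := g
  have mul_inv : G * G⁻¹ = 1 := PowerSeries.mul_inv_cancel G (by simp [G, hg])
  have derivative_eq : G * PowerSeries.derivative K F = k * PowerSeries.derivative K G * F := by
    simp only [F, G, PowerSeries.derivative_coe, ← coe_mul, h]
    rw [coe_mul, coe_mul, ← C_eq_natCast, coe_C, map_natCast]
  have natCast_mul_pow : (k : PowerSeries K) * G⁻¹ ^ (k - 1) * G⁻¹ = k * G⁻¹ ^ k := by
    rcases k with _ | k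
    · simp
    · rw [Nat.add_sub_cancel, mul_assoc, pow_succ]
  have quotient_eq_one : F * G⁻¹ ^ k = 1 := by
    refine PowerSeries.derivative.ext ?_ (by simp [F, G, hf, hg])
    rw [Derivation.leibniz, PowerSeries.derivative_pow, PowerSeries.derivative_inv',
      Derivation.map_one_eq_zero, smul_eq_mul, smul_eq_mul]
    linear_combination G⁻¹ ^ (k + 1) * derivative_eq
      - G⁻¹ ^ k * PowerSeries.derivative K F * mul_inv
      - F * G⁻¹ * PowerSeries.derivative K G * natCast_mul_pow
  have : F = G ^ k := by
    rw [← mul_one F, ← one_pow k, ← mul_inv, mul_pow, mul_left_comm, quotient_eq_one, mul_one]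
  exact coe_injective K (by simpa [F, G] using this)

theorem C_mapMatrix_smul (r : R) (T : Matrix n n R) :
    C.mapMatrix (r • T) = C r • C.mapMatrix T := by
  ext i j : 1
  simp

/-- The quadratic matrix pencil `1 - t A + t² P`, as a matrix of polynomials in `t`. -/
noncomputable def quadraticPencil (A P : Matrix n n R) : Matrix n n R[X] :=
  1 - (X : R[X]) • C.mapMatrix A + (X ^ 2 : R[X]) • C.mapMatrix P

theorem eval_quadraticPencil (A P : Matrix n n R) (r : R) :
    (evalRingHom r).mapMatrix (quadraticPencil A P) = 1 - r • A + r ^ 2 • P := by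
  ext i j
  simp [quadraticPencil, Matrix.one_apply, mul_comm r, mul_comm (r ^ 2), apply_ite (eval r)]

theorem derivative_quadraticPencil (A P : Matrix n n R) :
    (quadraticPencil A P).map derivative =
      (2 * X : R[X]) • C.mapMatrix P - C.mapMatrix A := by
  ext i j : 1
  simp only [quadraticPencil, Matrix.map_apply, Matrix.sub_apply, Matrix.add_apply,
    Matrix.smul_apply, smul_eq_mul, RingHom.mapMatrix_apply, Matrix.one_apply, derivative_add,
    derivative_sub, derivative_mul, derivative_X, derivative_X_sq, derivative_C,
    apply_ite derivative, derivative_one, derivative_zero, ite_self, C_ofNat]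
  ring

theorem smul_derivative_quadraticPencil {A P W : Matrix n n R} {a b c : R}
    (hAA : A * A = a • A + (2 : R) • P - W)
    (hAW : A * W + P * A = b • A + (2 * a) • P - (2 * c) • (1 : Matrix n n R))
    (hPW : P * W = (2 * b) • P - c • A) :
    (1 - C a * X + C b * X ^ 2 - C c * X ^ 3 : R[X]) • (quadraticPencil A P).map derivative =
      quadraticPencil A P *
        ((X : R[X]) • C.mapMatrix W - C.mapMatrix A - (2 * C c * X ^ 2) • 1) := by
  have hAA := congrArg C.mapMatrix hAA
  have hAW := congrArg C.mapMatrix hAW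
  have hPW := congrArg C.mapMatrix hPW
  simp only [map_mul, map_add, map_sub, C_mapMatrix_smul, map_one, map_ofNat] at hAA hAW hPW
  rw [derivative_quadraticPencil]
  simp only [quadraticPencil, add_mul, sub_mul, mul_sub, one_mul, Matrix.smul_mul,
    Matrix.mul_smul, mul_one]
  linear_combination (norm := module)
    (X ^ 2 : R[X]) • hAW - (X : R[X]) • hAA - (X ^ 3 : R[X]) • hPW

/-- With `f(t) = det (1 - t A + t² P)` and `g(t) = 1 - a t + b t² - c t³`, Jacobi's formula turns
the hypotheses into `g f' = k g' f`. -/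
theorem det_one_sub_add_eq_pow {K : Type*} [Field K] [CharZero K] {A P W : Matrix n n K}
    {a b c : K} {k : ℕ} (hAA : A * A = a • A + (2 : K) • P - W)
    (hAW : A * W + P * A = b • A + (2 * a) • P - (2 * c) • (1 : Matrix n n K))
    (hPW : P * W = (2 * b) • P - c • A) (trace_A : A.trace = k * a)
    (trace_W : W.trace = k * (2 * b)) (trace_c : 2 * c * Fintype.card n = k * (3 * c)) :
    (1 - A + P).det = (1 - a + b - c) ^ k := by
  let g : K[X] := 1 - C a * X + C b * X ^ 2 - C c * X ^ 3
  have trace_logDeriv : ((X : K[X]) • C.mapMatrix W - C.mapMatrix A -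
      (2 * C c * X ^ 2) • (1 : Matrix n n K[X])).trace = k * derivative g := by
    have trace_C (T : Matrix n n K) : (C.mapMatrix T).trace = C T.trace :=
      (AddMonoidHom.map_trace C T).symm
    have hc := congrArg C trace_c
    simp only [map_mul, map_natCast, map_ofNat] at hc
    simp only [g, Matrix.trace_sub, Matrix.trace_smul, trace_C, trace_A, trace_W,
      Matrix.trace_one, smul_eq_mul, map_mul, map_natCast, map_ofNat, derivative_sub,
      derivative_add, derivative_one, derivative_C_mul, derivative_X_pow, derivative_X]
    linear_combination -X ^ 2 * hc
  have det_pencil : (quadraticPencil A P).det = g ^ k := by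
    refine eq_pow_of_mul_derivative_eq ?_ (by simp [g]) ?_
    · rw [coeff_zero_eq_eval_zero, ← coe_evalRingHom, RingHom.map_det, eval_quadraticPencil]
      simp
    · rw [mul_derivative_det_eq_trace_mul_det (smul_derivative_quadraticPencil hAA hAW hPW),
        trace_logDeriv]
  have eval_one := eval_quadraticPencil A P 1
  rw [one_smul, one_pow, one_smul] at eval_one
  rw [← eval_one, ← RingHom.map_det, det_pencil]
  simp [g]

end PolynomialMatrices

/-- A vector space with a quadratic adjoint map `x ↦ x#` and a cubic norm, tied together by a
nondegenerate trace form as in the Freudenthal--Springer construction of exceptional Jordan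
algebras. No base point is chosen, so that only Jordan pair notions such as `U`, `V` and `bergman`
are available. -/
structure CubicNormStructure (K J : Type*) [Field K] [AddCommGroup J] [Module K J] where
  /-- the trace form `(x : y)` -/
  form : LinearMap.BilinForm K J
  /-- the adjoint `x ↦ x#` -/
  sharp : QuadraticMap K J J
  /-- the cubic norm -/
  norm : J → K
  form_isSymm : form.IsSymm
  form_separatingLeft : form.SeparatingLeft
  form_polar (x y z : J) :
    form (QuadraticMap.polar sharp x y) z = form x (QuadraticMap.polar sharp y z)
  form_sharp_self (x : J) : form (sharp x) x = 3 * norm x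
  sharp_sharp (x : J) : sharp (sharp x) = norm x • x

namespace CubicNormStructure

variable {K J : Type*} [Field K] [AddCommGroup J] [Module K J] (S : CubicNormStructure K J)

/-- The Freudenthal product `x × y = (x + y)# - x# - y#`. -/
def cross : J →ₗ[K] J →ₗ[K] J := S.sharp.polarBilin

local postfix:max "♯" => S.sharp
local infixl:70 "×ₛ" => S.cross

theorem form_comm (x y : J) : S.form x y = S.form y x := S.form_isSymm.eq x y

theorem cross_comm (x y : J) : x ×ₛ y = y ×ₛ x := QuadraticMap.polar_comm S.sharp x y

theorem cross_self (x : J) : x ×ₛ x = (2 : K) • x♯ := by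
  rw [ofNat_smul_eq_nsmul]
  exact QuadraticMap.polar_self S.sharp x

theorem sharp_add_smul (x y : J) (t : K) : (x + t • y)♯ = x♯ + t • (x ×ₛ y) + t ^ 2 • y♯ := by
  rw [QuadraticMap.map_add S.sharp, QuadraticMap.map_smul, QuadraticMap.polar_smul_right, pow_two]
  change _ = x♯ + t • QuadraticMap.polar S.sharp x y + _
  abel

theorem form_cross (x y z : J) : S.form (x ×ₛ y) z = S.form x (y ×ₛ z) := S.form_polar x y z

theorem form_cross_self (x y : J) : S.form (x ×ₛ y) x = 2 * S.form x♯ y := by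
  rw [cross_comm, form_cross, cross_self, map_smul, form_comm, smul_eq_mul]

theorem eq_of_forall_form_eq {x y : J} (h : ∀ z, S.form x z = S.form y z) : x = y :=
  sub_eq_zero.mp <| S.form_separatingLeft _ fun z => by
    rw [map_sub, LinearMap.sub_apply, h, sub_self]

/-- The quadratic operator `U_x z = (x : z) x - x# × z`. -/
def U (x : J) : Module.End K J := (S.form x).smulRight x - S.cross x♯

/-- The operator `V_{x,w} z = (x : w) z + (z : w) x - (x × z) × w`, which is the linearization
`z ↦ U_{x+z} w - U_x w - U_z w`. -/
def V (x w : J) : Module.End K J :=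
  S.form x w • 1 + (S.form.flip w).smulRight x - S.cross.flip w ∘ₗ S.cross x

/-- The Bergman operator of the Jordan pair `(J, J)`. -/
def bergman (x w : J) : Module.End K J := 1 - S.V x w + S.U x * S.U w

/-- The generic norm of the Jordan pair `(J, J)`. -/
def genericNorm (x w : J) : K := 1 - S.form x w + S.form x♯ w♯ - S.norm x * S.norm w

theorem U_apply (x z : J) : S.U x z = S.form x z • x - x♯ ×ₛ z := rfl

theorem V_apply (x w z : J) :
    S.V x w z = S.form x w • z + S.form z w • x - (x ×ₛ z) ×ₛ w := rfl

theorem trace_V_eq [FiniteDimensional K J] (x w : J) : LinearMap.trace K J (S.V x w) =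
    (Module.finrank K J + 1) * S.form x w -
      LinearMap.trace K J (S.cross.flip w ∘ₗ S.cross x) := by
  rw [V, map_sub, map_add, map_smul, LinearMap.trace_one, LinearMap.trace_smulRight,
    LinearMap.BilinForm.flip_apply, smul_eq_mul]
  ring

theorem V_self (x w : J) : S.V x w x = (2 : K) • (S.form x w • x - x♯ ×ₛ w) := by
  rw [V_apply, cross_self, map_smul, LinearMap.smul_apply]
  module

theorem U_U_apply (x w z : J) :
    S.U x (S.U w z) =
      S.form w z • S.U x w - S.form (x ×ₛ z) w♯ • x + x♯ ×ₛ (w♯ ×ₛ z) := by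
  rw [S.U_apply w, map_sub, map_smul, S.U_apply x (w♯ ×ₛ z), S.cross_comm w♯, form_cross]
  module

theorem U_sharp (x : J) : S.U x x♯ = S.norm x • x := by
  rw [U_apply, cross_self, sharp_sharp, form_comm, form_sharp_self]
  module

variable [CharZero K]

theorem norm_add_smul (x y : J) (t : K) :
    S.norm (x + t • y) =
      S.norm x + t * S.form x♯ y + t ^ 2 * S.form y♯ x + t ^ 3 * S.norm y := by
  have form_cross_right : S.form (x ×ₛ y) y = 2 * S.form y♯ x := by
    rw [cross_comm, form_cross_self]
  refine mul_left_cancel₀ (three_ne_zero (α := K)) ?_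
  rw [← form_sharp_self]
  simp only [sharp_add_smul, map_add, map_smul, LinearMap.add_apply, LinearMap.smul_apply,
    smul_eq_mul, form_cross_self, form_cross_right, form_sharp_self]
  ring

theorem cross_sharp_cross (x y : J) : x♯ ×ₛ (x ×ₛ y) = S.form x♯ y • x + S.norm x • y := by
  have expansion (t : K) :
      S.norm x • x + t • (x♯ ×ₛ (x ×ₛ y)) + t ^ 2 • ((x ×ₛ y)♯ + x♯ ×ₛ y♯) +
          t ^ 3 • ((x ×ₛ y) ×ₛ y♯) + t ^ 4 • S.norm y • y =
        (S.norm x + t * S.form x♯ y + t ^ 2 * S.form y♯ x + t ^ 3 * S.norm y) • (x + t • y) := by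
    rw [← norm_add_smul, ← sharp_sharp, ← sharp_sharp, ← sharp_sharp, S.sharp_add_smul x y,
      S.sharp_add_smul _ y♯, S.sharp_add_smul x♯, map_add, map_smul, LinearMap.add_apply,
      LinearMap.smul_apply]
    module
  linear_combination (norm := module) (2 / 3 : K) • expansion 1 - (2 / 3 : K) • expansion (-1)
    - (1 / 12 : K) • expansion 2 + (1 / 12 : K) • expansion (-2)

theorem cross_cross_sharp (x y : J) : x ×ₛ (x♯ ×ₛ y) = S.form x y • x♯ + S.norm x • y := by
  refine S.eq_of_forall_form_eq fun z => ?_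
  calc S.form (x ×ₛ (x♯ ×ₛ y)) z = S.form y (x♯ ×ₛ (x ×ₛ z)) := by
        rw [cross_comm, form_cross, S.cross_comm _ y, form_cross]
    _ = S.form (S.form x y • x♯ + S.norm x • y) z := by
        simp only [cross_sharp_cross, map_add, map_smul, LinearMap.add_apply, LinearMap.smul_apply,
          smul_eq_mul, S.form_comm y x]
        ring

theorem cross_cross_cross_add (x y z : J) :
    x ×ₛ ((x ×ₛ y) ×ₛ z) + y ×ₛ (x♯ ×ₛ z) =
      S.form y z • x♯ + S.form x z • (x ×ₛ y) + S.form x♯ y • z := by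
  have expansion (t : K) := S.cross_cross_sharp (x + t • y) z
  simp only [S.sharp_add_smul, norm_add_smul, map_add, map_smul, LinearMap.add_apply,
    LinearMap.smul_apply] at expansion
  linear_combination (norm := module) (1 / 2 : K) • expansion 1 - (1 / 2 : K) • expansion (-1)
    - S.cross_cross_sharp y z

theorem U_cross_self (x z : J) : S.U x (x ×ₛ z) = S.form x♯ z • x - S.norm x • z := by
  rw [U_apply, cross_sharp_cross, form_comm, form_cross_self]
  module

theorem V_sharp_self (w : J) : S.V w♯ w = (2 * S.norm w) • 1 := by
  ext z
  rw [V_apply, form_sharp_self, S.cross_comm _ w, cross_cross_sharp, S.form_comm w,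
    LinearMap.smul_apply, Module.End.one_apply]
  module

theorem V_sharp_cross (x w z : J) :
    S.V (x♯ ×ₛ w) w z = S.form x♯ w♯ • z - S.form x♯ z • w♯ + x♯ ×ₛ (w♯ ×ₛ z) := by
  have cross_cross := S.cross_cross_cross_add w x♯ z
  rw [S.form_comm w♯] at cross_cross
  have form_cross_right : S.form (x♯ ×ₛ w) w = 2 * S.form x♯ w♯ := by
    rw [S.cross_comm, form_cross_self, form_comm]
  rw [V_apply, form_cross_right, S.cross_comm _ w, S.cross_comm _ w, S.form_comm z]
  linear_combination (norm := module) -cross_cross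

theorem V_mul_V (x w : J) :
    S.V x w * S.V x w = S.form x w • S.V x w + (2 : K) • (S.U x * S.U w) - S.V (x♯ ×ₛ w) w := by
  ext z
  have cross_V_cross : (x ×ₛ ((x ×ₛ z) ×ₛ w)) ×ₛ w =
      S.form z w • (x♯ ×ₛ w) + S.form x w • ((x ×ₛ z) ×ₛ w) + (2 * S.form x♯ z) • w♯ -
        ((x♯ ×ₛ w) ×ₛ z) ×ₛ w := by
    rw [eq_sub_of_add_eq (S.cross_cross_cross_add x z w), S.cross_comm z]
    simp only [map_add, map_sub, map_smul, LinearMap.add_apply, LinearMap.sub_apply,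
      LinearMap.smul_apply, cross_self]
    module
  have V_cross : S.V x w ((x ×ₛ z) ×ₛ w) = S.form x w • ((x ×ₛ z) ×ₛ w) +
      (2 * S.form (x ×ₛ z) w♯) • x - (x ×ₛ ((x ×ₛ z) ×ₛ w)) ×ₛ w := by
    rw [V_apply, S.form_cross _ w, cross_self, map_smul, smul_eq_mul]
  have V_cross_apply : S.V (x♯ ×ₛ w) w z =
      (2 * S.form x♯ w♯) • z + S.form z w • (x♯ ×ₛ w) - ((x♯ ×ₛ w) ×ₛ z) ×ₛ w := by
    rw [V_apply, S.form_cross _ w, cross_self, map_smul, smul_eq_mul]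
  have U_U := S.U_U_apply x w z
  have V_V : S.V x w (S.V x w z) = S.form x w • S.V x w z + S.form z w • S.V x w x -
      S.V x w ((x ×ₛ z) ×ₛ w) := by
    conv_lhs => rw [S.V_apply x w z, map_sub, map_add, map_smul, map_smul]
  simp only [Module.End.mul_apply, LinearMap.add_apply, LinearMap.sub_apply, LinearMap.smul_apply]
  rw [U_U, V_V, V_cross, cross_V_cross, V_self, S.U_apply x w, S.form_comm w z]
  linear_combination (norm := module) (2 : K) • S.V_sharp_cross x w z - V_cross_apply

theorem V_sharp (x w : J) : S.V x w w♯ = (2 * S.norm w) • x := by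
  rw [V_apply, form_sharp_self, S.cross_comm x, S.cross_comm _ w, cross_cross_sharp, S.form_comm x]
  module

theorem V_cross (x w y : J) : S.V x w (x♯ ×ₛ y) =
    S.form x w • (x♯ ×ₛ y) + S.form (x♯ ×ₛ w) y • x - S.form x y • (x♯ ×ₛ w) -
      S.norm x • (w ×ₛ y) := by
  rw [V_apply, cross_cross_sharp, form_cross, S.cross_comm y, ← form_cross]
  simp only [map_add, map_smul, LinearMap.add_apply, LinearMap.smul_apply, S.cross_comm y w]
  module

theorem form_cross_sharp_cross (x w z : J) : S.form (x♯ ×ₛ w) (w♯ ×ₛ z) =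
    S.form x♯ w♯ * S.form w z + S.norm w * S.form x♯ z := by
  rw [form_cross, cross_cross_sharp, map_add, map_smul, map_smul, smul_eq_mul, smul_eq_mul,
    mul_comm]

theorem V_mul_V_sharp_cross (x w : J) :
    S.V x w * S.V (x♯ ×ₛ w) w + S.U x * S.U w * S.V x w =
      S.form x♯ w♯ • S.V x w + (2 * S.form x w) • (S.U x * S.U w) -
        (2 * (S.norm x * S.norm w)) • 1 := by
  ext z
  have V_V : S.V x w (S.V (x♯ ×ₛ w) w z) = S.form x♯ w♯ • S.V x w z -
      (S.form x♯ z * (2 * S.norm w)) • x + S.V x w (x♯ ×ₛ (w♯ ×ₛ z)) := by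
    rw [V_sharp_cross, map_add, map_sub, map_smul, map_smul, V_sharp, smul_smul]
  have U_V : S.U w (S.V x w z) = S.form x w • S.U w z + S.form z w • S.U w x -
      S.form (x ×ₛ z) w♯ • w + S.norm w • (x ×ₛ z) := by
    rw [S.V_apply x w z, map_sub, map_add, map_smul, map_smul, S.cross_comm _ w, U_cross_self,
      S.form_comm w♯]
    module
  have U_U_self : S.U x (S.U w x) =
      S.form x w • S.U x w - S.form x♯ w♯ • x + S.norm x • w♯ := by
    rw [S.U_apply w, map_sub, map_smul, S.cross_comm w♯, U_cross_self, S.form_comm w x]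
    module
  simp only [Module.End.mul_apply, LinearMap.add_apply, LinearMap.sub_apply, LinearMap.smul_apply,
    Module.End.one_apply]
  rw [V_V, V_cross, cross_cross_sharp, form_cross_sharp_cross, U_V]
  simp only [map_add, map_sub, map_smul]
  rw [U_U_self, U_cross_self, U_U_apply, S.U_apply x w, S.form_comm z w,
    S.cross_comm w♯ z, ← S.form_cross x z, S.cross_comm z]
  module

theorem U_polarised_sharp (x w z : J) :
    S.U x (S.form x♯ z • w + S.form w z • x♯ - (x♯ ×ₛ w) ×ₛ z) = S.norm x • S.V x w z := by
  have cross_cross : x♯ ×ₛ ((x♯ ×ₛ w) ×ₛ z) = S.norm x • (S.form w z • x + S.form x w • z -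
      (x ×ₛ z) ×ₛ w) + S.form x♯ z • (x♯ ×ₛ w) := by
    have linearized := S.cross_cross_cross_add x♯ w z
    simp only [sharp_sharp, map_smul, LinearMap.smul_apply, smul_eq_mul, S.cross_comm w]
      at linearized
    linear_combination (norm := module) linearized
  have form_cross_cross : S.form x ((x♯ ×ₛ w) ×ₛ z) =
      S.form x♯ z * S.form x w + S.norm x * S.form w z := by
    rw [S.cross_comm _ z, ← form_cross, form_comm, S.cross_comm x♯, form_cross,
      cross_sharp_cross, map_add, map_smul, map_smul, smul_eq_mul, smul_eq_mul, S.form_comm w x]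
  simp only [map_add, map_sub, map_smul]
  rw [U_sharp, S.U_apply x w, S.U_apply x (_ ×ₛ z), cross_cross, form_cross_cross, V_apply,
    S.form_comm z w]
  module

theorem U_V_sharp_cross (x w z : J) :
    S.U w (S.V (x♯ ×ₛ w) w z) = (2 * S.form x♯ w♯) • S.U w z -
      S.norm w • (S.form x♯ z • w + S.form w z • x♯ - (x♯ ×ₛ w) ×ₛ z) := by
  have cross_cross : w♯ ×ₛ (x♯ ×ₛ (w♯ ×ₛ z)) = S.norm w • (S.form x♯ z • w + S.form w z • x♯ -
      (x♯ ×ₛ w) ×ₛ z) + S.form x♯ w♯ • (w♯ ×ₛ z) := by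
    have linearized := S.cross_cross_cross_add w♯ z x♯
    simp only [sharp_sharp, map_smul, LinearMap.smul_apply, smul_eq_mul, S.cross_comm _ x♯,
      S.cross_comm z, S.form_comm _ x♯] at linearized
    linear_combination (norm := module) linearized
  have form_cross_cross : S.form w (x♯ ×ₛ (w♯ ×ₛ z)) =
      S.form x♯ w♯ * S.form w z + S.norm w * S.form x♯ z := by
    rw [← form_cross, S.cross_comm w, form_cross_sharp_cross]
  rw [V_sharp_cross, map_add, map_sub, map_smul, map_smul, U_sharp, S.U_apply w (x♯ ×ₛ _),
    cross_cross, form_cross_cross, S.U_apply w z]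
  module

theorem U_mul_U_mul_V_sharp_cross (x w : J) :
    S.U x * S.U w * S.V (x♯ ×ₛ w) w =
      (2 * S.form x♯ w♯) • (S.U x * S.U w) - (S.norm x * S.norm w) • S.V x w := by
  ext z
  simp only [Module.End.mul_apply, LinearMap.sub_apply, LinearMap.smul_apply]
  rw [U_V_sharp_cross, map_sub, map_smul, map_smul, U_polarised_sharp, smul_smul,
    mul_comm (S.norm x)]

theorem det_bergman [FiniteDimensional K J] {k : ℕ}
    (trace_V : ∀ x w, LinearMap.trace K J (S.V x w) = k * S.form x w) (x w : J) :
    LinearMap.det (S.bergman x w) = S.genericNorm x w ^ k := by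
  let b := Module.finBasis K J
  let φ := LinearMap.toMatrixAlgEquiv b
  have trace_φ (T : Module.End K J) : (φ T).trace = LinearMap.trace K J T :=
    (LinearMap.trace_eq_matrix_trace K b T).symm
  have trace_norm_smul : 2 * S.norm w * Module.finrank K J = k * (3 * S.norm w) := by
    rw [← form_sharp_self, ← trace_V, V_sharp_self, map_smul, LinearMap.trace_one, smul_eq_mul]
  have V_mul_V := congrArg φ (S.V_mul_V x w)
  have V_mul_V_cross := congrArg φ (S.V_mul_V_sharp_cross x w)
  have UU_mul_V_cross := congrArg φ (S.U_mul_U_mul_V_sharp_cross x w)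
  simp only [map_mul φ, map_add, map_sub, map_smul, map_one]
    at V_mul_V V_mul_V_cross UU_mul_V_cross
  have det_eq := det_one_sub_add_eq_pow (k := k) V_mul_V V_mul_V_cross UU_mul_V_cross
    (by rw [trace_φ, trace_V])
    (by rw [trace_φ, trace_V, form_cross, cross_self, map_smul, smul_eq_mul])
    (by rw [Fintype.card_fin]; linear_combination S.norm x * trace_norm_smul)
  rw [← LinearMap.det_toMatrix b]
  change (φ (S.bergman x w)).det = _
  rw [bergman, map_add, map_sub, map_one, map_mul, det_eq, genericNorm]

end CubicNormStructure

namespace Octonion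

section

variable {R : Type} [CommRing R]

instance : StarRing (Octonion R) where
  star_mul a b := by ext <;> simp
  star_add := star_add

theorem norm_star (a : Octonion R) : norm (star a) = norm a := by
  simp [norm, Quaternion.normSq_def']

theorem norm_smul (r : R) (a : Octonion R) : norm (r • a) = r ^ 2 * norm a := by
  simp only [norm, smul_fst, smul_snd, Quaternion.normSq_smul]
  ring

theorem bil_self (a : Octonion R) : bil a a = 2 * norm a := by
  rw [bil, ← two_smul R a, norm_smul]
  ring

theorem bil_smul_right (r : R) (a b : Octonion R) : bil a (r • b) = r * bil a b := by
  rw [bil_comm, bil_smul_left, bil_comm]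

theorem bil_zero_right (a : Octonion R) : bil a 0 = 0 := by
  simpa using bil_smul_right 0 a 0

theorem bil_neg_left (a b : Octonion R) : bil (-a) b = -bil a b := by
  simpa using bil_smul_left (-1) a b

theorem bil_neg_neg (a b : Octonion R) : bil (-a) (-b) = bil a b := by
  rw [bil_neg_left, bil_comm, bil_neg_left, neg_neg, bil_comm]

theorem bil_sub_left (a b c : Octonion R) : bil (a - b) c = bil a c - bil b c := by
  rw [sub_eq_add_neg, bil_add_left, bil_neg_left, sub_eq_add_neg]

theorem norm_sub (a b : Octonion R) : norm (a - b) = norm a + norm b - bil a b := by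
  have norm_add : norm (a - b + b) = norm (a - b) + norm b + (bil a b - bil b b) := by
    rw [← bil_sub_left, bil]
    ring
  rw [sub_add_cancel, bil_self] at norm_add
  linear_combination -norm_add

theorem bil_star_star (a b : Octonion R) : bil (star a) (star b) = bil a b := by
  rw [bil, ← star_add, norm_star, norm_star, norm_star, bil]

theorem bil_mul_mul_left (a b c : Octonion R) : bil (a * b) (a * c) = norm a * bil b c := by
  simp only [bil, ← mul_add, norm_mul]
  ring

theorem bil_mul_mul_right (a b c : Octonion R) : bil (b * a) (c * a) = norm a * bil b c := by
  simp only [bil, ← add_mul, norm_mul]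
  ring

theorem bil_mul_star_cycle (a b c : Octonion R) :
    bil (a * b) (star c) = bil (b * c) (star a) := by
  simp only [bil_eq, mul_fst, mul_snd, star_fst, star_snd, Quaternion.re_sub, Quaternion.imI_sub,
    Quaternion.imJ_sub, Quaternion.imK_sub, Quaternion.re_add, Quaternion.imI_add,
    Quaternion.imJ_add, Quaternion.imK_add, Quaternion.re_mul, Quaternion.imI_mul,
    Quaternion.imJ_mul, Quaternion.imK_mul, Quaternion.re_neg, Quaternion.imI_neg,
    Quaternion.imJ_neg, Quaternion.imK_neg, Quaternion.re_star, Quaternion.imI_star,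
    Quaternion.imJ_star, Quaternion.imK_star]
  ring

theorem star_mul_mul_self (a b : Octonion R) : star a * (a * b) = norm a • b := by
  ext <;> simp [norm, Quaternion.normSq_def'] <;> ring

theorem mul_star_mul_self (a b : Octonion R) : a * (star a * b) = norm a • b := by
  simpa [norm_star] using star_mul_mul_self (star a) b

theorem mul_mul_star_self (a b : Octonion R) : (a * b) * star b = norm b • a := by
  simpa [star_smul', norm_star] using congrArg star (mul_star_mul_self b (star a))

theorem star_mul_mul_add_star_mul_mul (a b c : Octonion R) :
    star a * (b * c) + star b * (a * c) = bil a b • c := by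
  have expansion := star_mul_mul_self (a + b) c
  simp only [star_add, add_mul, mul_add, star_mul_mul_self] at expansion
  rw [bil]
  linear_combination (norm := module) expansion

/-- A form of the middle Moufang identity `(a b) (c a) = a (b c) a`. -/
theorem mul_mul_mul_eq_bil_smul_sub (a b c : Octonion R) :
    (a * b) * (c * a) = bil (c * a) (star b) • a - norm a • (star c * star b) := by
  have star_mul_mul : star (a * b) * a = norm a • star b := by
    simpa [norm_star] using mul_mul_star_self (star b) (star a)
  have bil_eq_bil : bil (star (a * b)) c = bil (c * a) (star b) := by
    rw [← bil_star_star, star_star, bil_mul_star_cycle, bil_mul_star_cycle]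
  rw [← bil_eq_bil, ← star_mul_mul_add_star_mul_mul, star_star, star_mul_mul, mul_smul',
    add_sub_cancel_right]

/-- The eight coordinates on the Cayley algebra, with respect to the basis `unit`. -/
def equivFun : Octonion R ≃ₗ[R] (Fin 8 → R) where
  toFun a := ![a.fst.re, a.fst.imI, a.fst.imJ, a.fst.imK,
    a.snd.re, a.snd.imI, a.snd.imJ, a.snd.imK]
  invFun f := ⟨⟨f 0, f 1, f 2, f 3⟩, ⟨f 4, f 5, f 6, f 7⟩⟩
  map_add' a b := by ext k; fin_cases k <;> rfl
  map_smul' c a := by ext k; fin_cases k <;> rfl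
  left_inv _ := rfl
  right_inv f := by ext k; fin_cases k <;> rfl

theorem norm_eq_dotProduct (a : Octonion R) : norm a = equivFun a ⬝ᵥ equivFun a := by
  simp only [norm, Quaternion.normSq_def', dotProduct, Fin.sum_univ_eight, pow_two, ← add_assoc]
  rfl

theorem bil_eq_two_mul_dotProduct (a b : Octonion R) :
    bil a b = 2 * (equivFun a ⬝ᵥ equivFun b) := by
  simp only [bil, norm_eq_dotProduct, map_add, add_dotProduct, dotProduct_add,
    dotProduct_comm (equivFun b)]
  ring

/-- The eight standard units `1, i, j, k, v, vi, vj, vk`. -/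
def unit (k : Fin 8) : Octonion R := equivFun.symm (Pi.single k 1)

theorem bil_unit (a : Octonion R) (k : Fin 8) : bil a (unit k) = 2 * equivFun a k := by
  rw [bil_eq_two_mul_dotProduct, unit, LinearEquiv.apply_symm_apply, dotProduct_single_one]

theorem norm_unit (k : Fin 8) : norm (unit k : Octonion R) = 1 := by
  rw [norm_eq_dotProduct, unit, LinearEquiv.apply_symm_apply, dotProduct_single_one,
    Pi.single_eq_same]

theorem sum_bil_unit_mul_bil_unit (a b : Octonion R) :
    ∑ k, bil a (unit k) * bil b (unit k) = 2 * bil a b := by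
  rw [bil_eq_two_mul_dotProduct, dotProduct, Finset.mul_sum, Finset.mul_sum]
  exact Finset.sum_congr rfl fun k _ => by rw [bil_unit, bil_unit]; ring

end

theorem conj_conj (a : Octonion ℂ) : conj (conj a) = a := by
  ext <;> simp [conj]

theorem bil_conj (a b : Octonion ℂ) :
    bil (conj a) (conj b) = starRingEnd ℂ (bil a b) := by
  simp only [bil_eq, conj, map_mul, map_add, map_ofNat]
  rfl

theorem norm_conj (a : Octonion ℂ) : norm (conj a) = starRingEnd ℂ (norm a) := by
  simp [norm, conj, Quaternion.normSq_def']

theorem conj_sub (a b : Octonion ℂ) : conj (a - b) = conj a - conj b := by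
  ext <;> simp [conj]

theorem conj_mul (a b : Octonion ℂ) : conj (a * b) = conj a * conj b := by
  ext <;> simp [conj]

theorem conj_star (a : Octonion ℂ) : conj (star a) = star (conj a) := by
  ext <;> simp [conj]

end Octonion

theorem diag_adj (a : H3) (i : Fin 3) : diag (adj a) i =
    diag a (i + 1) * diag a (i + 2) - Octonion.norm (off a i) := by
  rw [adj, diag_of]

theorem off_adj (a : H3) (i : Fin 3) : off (adj a) i =
    star (off a (i + 1) * off a (i + 2) - diag a i • star (off a i)) := by
  rw [adj, off_of]

theorem cross_self (a : H3) : cross a a = (2 : ℂ) • adj a := by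
  refine H3_ext (fun i => ?_) (fun i => ?_)
  · simp only [diag_cross, diag_smul, diag_adj, Octonion.bil_self]
    ring
  · simp only [off_cross, off_smul, off_adj, ← Octonion.star_smul']
    congr 1
    module

theorem adj_smul (r : ℂ) (a : H3) : adj (r • a) = r ^ 2 • adj a := by
  have cross_smul_self := cross_self (r • a)
  rw [cross_smul_left, cross_smul_right, cross_self] at cross_smul_self
  linear_combination (norm := module) (-1 / 2 : ℂ) • cross_smul_self

theorem bil_add_right (a b c : H3) : bil a (b + c) = bil a b + bil a c := by
  rw [bil_comm, bil_add_left, bil_comm b, bil_comm c]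

theorem bil_smul_right (r : ℂ) (a b : H3) : bil a (r • b) = r * bil a b := by
  rw [bil_comm, bil_smul_left, bil_comm b]

theorem bil_off_cross (a b c : H3) (i : Fin 3) :
    Octonion.bil (off (cross a b) i) (off c i) =
      Octonion.bil (off a (i + 1) * off b (i + 2)) (star (off c i))
        + Octonion.bil (off b (i + 1) * off a (i + 2)) (star (off c i))
        - diag a i * Octonion.bil (off b i) (off c i)
        - diag b i * Octonion.bil (off a i) (off c i) := by
  rw [off_cross, ← Octonion.bil_star_star, star_star]
  simp only [Octonion.bil_sub_left, Octonion.bil_add_left, Octonion.bil_smul_left,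
    Octonion.bil_star_star]

theorem bil_cross_left (a b c : H3) : bil (cross a b) c = bil a (cross b c) := by
  have cycle (i : Fin 3) :
      Octonion.bil (off a (i + 1) * off b (i + 2)) (star (off c i))
        = Octonion.bil (off b (i + 2) * off c i) (star (off a (i + 1))) :=
    Octonion.bil_mul_star_cycle _ _ _
  have cycle_cycle (i : Fin 3) :
      Octonion.bil (off b (i + 1) * off a (i + 2)) (star (off c i))
        = Octonion.bil (off c i * off b (i + 1)) (star (off a (i + 2))) := by
    rw [Octonion.bil_mul_star_cycle, Octonion.bil_mul_star_cycle]
  rw [bil_comm a]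
  simp only [bil, bil_off_cross, diag_cross, Fin.sum_univ_three, Fin.isValue, Fin.reduceAdd,
    zero_add, cycle, cycle_cycle, Octonion.bil_comm (off c _) (off a _),
    Octonion.bil_comm (off b _) (off a _)]
  ring

theorem bil_adj_self (x : H3) : bil (adj x) x = 3 * det x := by
  rw [det]
  ring

theorem det_eq (x : H3) (i : Fin 3) : det x = diag x i * diag x (i + 1) * diag x (i + 2)
    - (diag x i * Octonion.norm (off x i) + diag x (i + 1) * Octonion.norm (off x (i + 1))
      + diag x (i + 2) * Octonion.norm (off x (i + 2)))
    + Octonion.bil (off x (i + 1) * off x (i + 2)) (star (off x i)) := by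
  have bil_cross_self := congrArg (bil · x) (cross_self x)
  have cycle := Octonion.bil_mul_star_cycle (off x 0) (off x 1) (off x 2)
  have cycle' := Octonion.bil_mul_star_cycle (off x 2) (off x 0) (off x 1)
  simp only [bil_smul_left, bil_adj_self] at bil_cross_self
  simp only [bil, bil_off_cross, diag_cross, Octonion.bil_self, Fin.sum_univ_three, Fin.isValue,
    Fin.reduceAdd, zero_add] at bil_cross_self
  fin_cases i <;> simp only [Fin.isValue, Fin.reduceAdd, Fin.zero_eta, Fin.mk_one,
    Fin.reduceFinMk, zero_add]
  · linear_combination -bil_cross_self / 6 + cycle * (2 / 3) + cycle' / 3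
  · linear_combination -bil_cross_self / 6 - cycle / 3 - cycle' * (2 / 3)
  · linear_combination -bil_cross_self / 6 - cycle / 3 + cycle' / 3

theorem adj_adj (x : H3) : adj (adj x) = det x • x := by
  have add_one_add_one (i : Fin 3) : i + 1 + 1 = i + 2 := add_assoc i 1 1
  have add_one_add_two (i : Fin 3) : i + 1 + 2 = i := by grind
  have add_two_add_one (i : Fin 3) : i + 2 + 1 = i := by grind
  have add_two_add_two (i : Fin 3) : i + 2 + 2 = i + 1 := add_assoc i 2 2
  refine H3_ext (fun i => ?_) (fun i => ?_)
  · rw [det_eq x i]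
    simp only [diag_adj, off_adj, diag_smul, add_one_add_one, add_one_add_two, add_two_add_one,
      add_two_add_two, Octonion.norm_star, Octonion.norm_sub, Octonion.norm_smul,
      Octonion.norm_mul, Octonion.bil_smul_right]
    ring
  · have expansion : off (adj x) (i + 1) * off (adj x) (i + 2) -
        diag (adj x) i • star (off (adj x) i) = det x • star (off x i) := by
      have star_mul_mul := Octonion.mul_mul_star_self (star (off x i)) (star (off x (i + 2)))
      have bil_star_mul_star : Octonion.bil (star (off x (i + 1)) * star (off x i))
          (off x (i + 2)) = Octonion.bil (off x (i + 1) * off x (i + 2)) (star (off x i)) := by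
        rw [← Octonion.bil_star_star, star_mul, star_star, star_star,
          Octonion.bil_mul_star_cycle]
      rw [star_star, Octonion.norm_star] at star_mul_mul
      rw [det_eq x i]
      simp only [diag_adj, off_adj, add_one_add_one, add_one_add_two, add_two_add_one,
        add_two_add_two, Octonion.star_smul', star_sub, star_star, star_mul, sub_mul, mul_sub,
        Octonion.smul_mul, Octonion.mul_smul', Octonion.mul_mul_mul_eq_bil_smul_sub,
        Octonion.norm_star, Octonion.mul_star_mul_self, star_mul_mul, bil_star_mul_star]
      module
    rw [off_adj (adj x), expansion, off_smul, Octonion.star_smul', star_star]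

/-- The diagonal idempotent `eᵢ`. -/
def diagUnit (i : Fin 3) : H3 := of (Pi.single i 1) 0

/-- The off-diagonal element `Fᵢ(u)`. -/
def offEmbed (i : Fin 3) (u : Octonion ℂ) : H3 := of 0 (Pi.single i u)

theorem bil_diagUnit (a : H3) (i : Fin 3) : bil a (diagUnit i) = diag a i := by
  simp [bil, diagUnit, Pi.single_apply, Octonion.bil_zero_right]

theorem bil_offEmbed (a : H3) (i : Fin 3) (u : Octonion ℂ) :
    bil a (offEmbed i u) = Octonion.bil (off a i) u := by
  rw [bil, Finset.sum_eq_zero (by simp [offEmbed]), zero_add, Finset.sum_eq_single i]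
  · rw [offEmbed, off_of, Pi.single_eq_same]
  · intro j _ j_ne
    rw [offEmbed, off_of, Pi.single_eq_of_ne j_ne, Octonion.bil_zero_right]
  · simp

theorem eq_zero_of_forall_bil_eq_zero {a : H3} (h : ∀ b, bil a b = 0) : a = 0 := by
  refine H3_ext (fun i => ?_) (fun i => ?_)
  · rw [← bil_diagUnit, h]
    rfl
  · refine Octonion.equivFun.injective (funext fun k => ?_)
    have bil_unit := h (offEmbed i (Octonion.unit k))
    rw [bil_offEmbed, Octonion.bil_unit] at bil_unit
    exact ((mul_eq_zero.mp bil_unit).resolve_left two_ne_zero).trans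
      (congrFun (map_zero Octonion.equivFun) k).symm

/-- The 27 complex coordinates on `H3`. -/
def equivFun : H3 ≃ₗ[ℂ] (Fin 3 ⊕ Fin 3 × Fin 8 → ℂ) where
  toFun a := Sum.elim (diag a) fun p => Octonion.equivFun (off a p.1) p.2
  invFun f := of (fun i => f (.inl i)) fun i => Octonion.equivFun.symm fun k => f (.inr (i, k))
  map_add' a b := by ext (i | i) <;> simp
  map_smul' c a := by ext (i | i) <;> simp
  left_inv a := by refine H3_ext (fun i => ?_) (fun i => ?_) <;> simp
  right_inv f := by ext (i | i) <;> simp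

/-- The basis of `H3` given by the `eᵢ` and the `Fᵢ(u)`, for `u` a standard unit. -/
noncomputable def basis : Module.Basis (Fin 3 ⊕ Fin 3 × Fin 8) ℂ H3 := .ofEquivFun equivFun

theorem basis_inl (i : Fin 3) : basis (.inl i) = diagUnit i := by
  rw [basis, Module.Basis.coe_ofEquivFun, LinearEquiv.symm_apply_eq]
  ext (j | p)
  · simp [equivFun, diagUnit, Pi.single_apply]
  · simp [equivFun, diagUnit]

theorem basis_inr (i : Fin 3) (k : Fin 8) :
    basis (.inr (i, k)) = offEmbed i (Octonion.unit k) := by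
  rw [basis, Module.Basis.coe_ofEquivFun, LinearEquiv.symm_apply_eq]
  ext (j | ⟨j, l⟩)
  · simp [equivFun, offEmbed]
  · obtain rfl | j_ne := eq_or_ne j i
    · simp [equivFun, offEmbed, Octonion.unit, Pi.single_apply]
    · simp [equivFun, offEmbed, Pi.single_apply, j_ne]

instance : Module.Finite ℂ H3 := .of_basis basis

theorem trace_eq (T : Module.End ℂ H3) : LinearMap.trace ℂ H3 T =
    ∑ i, bil (T (diagUnit i)) (diagUnit i) +
      1 / 2 * ∑ i, ∑ k, bil (T (offEmbed i (Octonion.unit k))) (offEmbed i (Octonion.unit k)) := by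
  rw [LinearMap.trace_eq_matrix_trace ℂ basis, Matrix.trace, Fintype.sum_sum_type,
    Fintype.sum_prod_type]
  simp only [Matrix.diag_apply, LinearMap.toMatrix_apply, basis_inl, basis_inr, bil_diagUnit,
    bil_offEmbed, Octonion.bil_unit, ← Finset.mul_sum]
  rw [one_div, inv_mul_cancel_left₀ two_ne_zero]
  rfl

theorem bil_cross_diagUnit (x w : H3) (i : Fin 3) :
    bil (cross x (diagUnit i)) (cross w (diagUnit i)) =
      diag x (i + 1) * diag w (i + 1) + diag x (i + 2) * diag w (i + 2)
        + Octonion.bil (off x i) (off w i) := by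
  simp only [bil, diag_cross, off_cross, Octonion.bil_star_star, diagUnit, diag_of, off_of,
    Fin.sum_univ_three]
  fin_cases i <;> simp [Octonion.bil_zero_right, Octonion.bil_neg_neg, Octonion.bil_star_star] <;>
    ring

theorem bil_cross_offEmbed (x w : H3) (i : Fin 3) (u : Octonion ℂ) :
    bil (cross x (offEmbed i u)) (cross w (offEmbed i u)) =
      Octonion.bil (off x i) u * Octonion.bil (off w i) u
        + Octonion.norm u * (2 * (diag x i * diag w i)
          + Octonion.bil (off x (i + 1)) (off w (i + 1))
          + Octonion.bil (off x (i + 2)) (off w (i + 2))) := by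
  simp only [bil, diag_cross, off_cross, Octonion.bil_star_star, offEmbed, diag_of, off_of,
    Fin.sum_univ_three]
  fin_cases i <;> simp [Octonion.bil_zero_right, Octonion.bil_neg_neg, Octonion.bil_smul_left,
    Octonion.bil_smul_right, Octonion.norm_star, Octonion.bil_mul_mul_left,
    Octonion.bil_mul_mul_right, Octonion.bil_self] <;> ring

/-- The cubic norm structure carried by `H₃(𝕆)`. -/
noncomputable def cubicNormStructure : CubicNormStructure ℂ H3 where
  form := LinearMap.mk₂ ℂ bil bil_add_left bil_smul_left bil_add_right bil_smul_right
  sharp := .ofPolar adj (fun r a => by rw [adj_smul, pow_two]) cross_add_left cross_smul_left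
  norm := det
  form_isSymm := ⟨bil_comm⟩
  form_separatingLeft _ h := eq_zero_of_forall_bil_eq_zero h
  form_polar := bil_cross_left
  form_sharp_self := bil_adj_self
  sharp_sharp := adj_adj

theorem trace_cross_cross (x w : H3) :
    LinearMap.trace ℂ H3 (cubicNormStructure.cross.flip w ∘ₗ cubicNormStructure.cross x) =
      10 * bil x w := by
  have bil_cross_cross (z : H3) :
      bil ((cubicNormStructure.cross.flip w ∘ₗ cubicNormStructure.cross x) z) z =
        bil (cross x z) (cross w z) :=
    bil_cross_left (cross x z) w z
  simp only [trace_eq, bil_cross_cross, bil_cross_diagUnit, bil_cross_offEmbed,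
    Octonion.norm_unit, Finset.sum_add_distrib, Octonion.sum_bil_unit_mul_bil_unit,
    Finset.sum_const, Finset.card_univ, Fintype.card_fin, one_mul]
  simp only [bil, Fin.sum_univ_three, Fin.isValue, Fin.reduceAdd, zero_add, nsmul_eq_mul,
    Nat.cast_ofNat]
  ring

theorem finrank_H3 : Module.finrank ℂ H3 = 27 := by
  rw [Module.finrank_eq_card_basis basis, Fintype.card_sum, Fintype.card_prod, Fintype.card_fin,
    Fintype.card_fin]

theorem trace_V (x w : H3) : LinearMap.trace ℂ H3 (cubicNormStructure.V x w) = 18 * bil x w := by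
  have form_eq : cubicNormStructure.form x w = bil x w := rfl
  rw [CubicNormStructure.trace_V_eq, trace_cross_cross, finrank_H3, form_eq]
  push_cast
  ring

theorem diag_conj (a : H3) (i : Fin 3) : diag (conj a) i = starRingEnd ℂ (diag a i) := by
  rw [conj, diag_of]

theorem off_conj (a : H3) (i : Fin 3) : off (conj a) i = Octonion.conj (off a i) := by
  rw [conj, off_of]

theorem conj_conj (a : H3) : conj (conj a) = a :=
  H3_ext (fun i => by rw [diag_conj, diag_conj, starRingEnd_self_apply])
    (fun i => by rw [off_conj, off_conj, Octonion.conj_conj])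

theorem bil_conj (a b : H3) : bil (conj a) (conj b) = starRingEnd ℂ (bil a b) := by
  simp only [bil, diag_conj, off_conj, Octonion.bil_conj, map_add, map_sum, map_mul]

theorem conj_sub (a b : H3) : conj (a - b) = conj a - conj b := by
  rw [eq_sub_iff_add_eq, ← conj_add, sub_add_cancel]

theorem conj_adj (a : H3) : conj (adj a) = adj (conj a) := by
  refine H3_ext (fun i => ?_) (fun i => ?_)
  · simp only [diag_conj, diag_adj, off_conj, Octonion.norm_conj, map_sub, map_mul]
  · simp only [off_conj, off_adj, diag_conj, Octonion.conj_star, Octonion.conj_sub,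
      Octonion.conj_mul, Octonion.conj_smul]

theorem conj_cross (a b : H3) : conj (cross a b) = cross (conj a) (conj b) := by
  simp only [cross, conj_sub, conj_adj, conj_add]

theorem D_eq_V (x y : H3) : D x y = cubicNormStructure.V x (conj y) := rfl

theorem Q_eq_U_conj (x y : H3) : Q x y = cubicNormStructure.U x (conj y) := rfl

theorem conj_Q (x y : H3) : conj (Q x y) = cubicNormStructure.U (conj x) y := by
  have Q_apply : Q x y = herm x y • x - cross (adj x) (conj y) := rfl
  have bil_eq : bil (conj x) y = starRingEnd ℂ (herm x y) := by rw [herm, ← bil_conj, conj_conj]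
  rw [Q_apply, conj_sub, conj_smul, conj_cross, conj_adj, conj_conj, ← bil_eq]
  rfl

theorem B_eq_bergman (x y : H3) : B x y = cubicNormStructure.bergman x (conj y) := by
  ext1 z
  have Q_Q : Q x (Q y z) = cubicNormStructure.U x (cubicNormStructure.U (conj y) z) := by
    rw [Q_eq_U_conj, conj_Q]
  rw [B, LinearMap.add_apply, LinearMap.comp_apply, Q_Q, D_eq_V]
  rfl

theorem genericNorm_conj (x y : H3) : cubicNormStructure.genericNorm x (conj y) =
    1 - herm x y + herm (adj x) (adj y) - det x * det (conj y) := by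
  rw [herm, herm, conj_adj]
  rfl

end ExceptionalJordan

theorem mainTheorem4 (x y : ExceptionalJordan.H3) :
    LinearMap.trace ℂ ExceptionalJordan.H3 (ExceptionalJordan.D x y)
        = 18 * ExceptionalJordan.herm x y ∧
      LinearMap.det (ExceptionalJordan.B x y)
        = (1 - ExceptionalJordan.herm x y
            + ExceptionalJordan.herm (ExceptionalJordan.adj x) (ExceptionalJordan.adj y)
            - ExceptionalJordan.det x * ExceptionalJordan.det (ExceptionalJordan.conj y)) ^ 18 := by
  refine ⟨ExceptionalJordan.trace_V x (ExceptionalJordan.conj y), ?_⟩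
  rw [ExceptionalJordan.B_eq_bergman,
    ExceptionalJordan.cubicNormStructure.det_bergman ExceptionalJordan.trace_V,
    ExceptionalJordan.genericNorm_conj]
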